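/- Let $K$ be a field, let $n\ge 2$, and let $\mathbf a=(a_1,\dots,a_n)$ be a sequence of distinct positive integers with $\gcd(a_1,\dots,a_n)=1$ and $a_n>a_i$ for all $i<n$. Let $I(\mathbf a)\subset S=K[x_1,\dots,x_n]$ be the kernel of the $K$-algebra homomorphism $S\to K[t]$, $x_i\mapsto t^{a_i}$, and let $I(\mathbf a)^h\subset S[x_0]$ be its homogenization with respect to $x_0$, that is, the ideal generated by the homogenizations $f^h=x_0^{\deg f}f(x_1/x_0,\dots,x_n/x_0)$ of all nonzero $f\in I(\mathbf a)$. Let $<$ be a (graded) reverse lexicographic order on $S$, for any ordering of the variables in which $x_n$ is the smallest variable, and let $\operatorname{in}_<(I(\mathbf a))$ be the ideal generated by the initial monomials of the nonzero elements of $I(\mathbf a)$. Suppose that the projective monomial curve $\overline{C(\mathbf a)}$ is arithmetically Cohen--Macaulay, i.e. that the ring $S[x_0]/I(\mathbf a)^h$ is Cohen--Macaulay. Then $$\mu\bigl(\operatorname{in}_<(I(\mathbf a))\bigr)\le\binom{a_n}{n-2}.$$ That is, the unique minimal set of monomial generators of $\operatorname{in}_<(I(\mathbf a))$ has at most $\binom{a_n}{n-2}$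 elements, and hence so has a generating set of minimal cardinality. -/

import Mathlib

noncomputable section

namespace MonomialCurve

open MvPolynomial

/-! ### Cohen-Macaulay rings -/

/-- A Noetherian local ring is Cohen-Macaulay if its depth equals its Krull dimension, that is, if
its maximal ideal contains a regular sequence whose length is the Krull dimension. -/
def IsCohenMacaulayLocalRing (R : Type*) [CommRing R] [IsLocalRing R] : Prop :=
  IsNoetherianRing R ∧
    ∃ rs : List R, (∀ r ∈ rs, r ∈ IsLocalRing.maximalIdeal R) ∧
      RingTheory.Sequence.IsRegular R rs ∧ (rs.length : WithBot ℕ∞) = ringKrullDim R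

/-- A Noetherian ring is Cohen-Macaulay if its localization at every maximal ideal is. -/
def IsCohenMacaulayRing (R : Type*) [CommRing R] : Prop :=
  IsNoetherianRing R ∧
    ∀ (M : Ideal R) [M.IsMaximal], IsCohenMacaulayLocalRing (Localization.AtPrime M)

/-- An ideal `I` of a ring `R` is a Cohen-Macaulay ideal if the ring `R ⧸ I` is Cohen-Macaulay. -/
def IsCohenMacaulayIdeal {R : Type*} [CommRing R] (I : Ideal R) : Prop :=
  IsCohenMacaulayRing (R ⧸ I)

/-! ### Monomial curves and their projective closures -/

/-- The ideal `I(a)` of `K[x_1, …, x_n]`: the kernel of `x_i ↦ t ^ a_i`. -/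
def toricIdeal (K : Type*) [Field K] {n : ℕ} (a : Fin n → ℕ) : Ideal (MvPolynomial (Fin n) K) :=
  RingHom.ker (aeval fun i => (Polynomial.X : Polynomial K) ^ a i :
    MvPolynomial (Fin n) K →ₐ[K] Polynomial K)

/-- The homogenization `f ^ h = ∑ c_u x ^ u x_0 ^ (deg f - |u|)` of `f = ∑ c_u x ^ u`. The new
variable `x_0` has index `0`; the old variable with index `i` becomes the one with index
`i.succ`. -/
def homogenize {K : Type*} [Field K] {n : ℕ} (f : MvPolynomial (Fin n) K) :
    MvPolynomial (Fin (n + 1)) K :=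
  ∑ u ∈ f.support, monomial (Finsupp.cons (f.totalDegree - u.degree) u) (coeff u f)

/-- The homogenization `I ^ h` of an ideal `I`: the ideal generated by all `f ^ h` with `f ∈ I`. -/
def homogenizeIdeal {K : Type*} [Field K] {n : ℕ} (I : Ideal (MvPolynomial (Fin n) K)) :
    Ideal (MvPolynomial (Fin (n + 1)) K) :=
  Ideal.span (homogenize '' (I : Set (MvPolynomial (Fin n) K)))

/-- The projective monomial curve of `a` over `K` is arithmetically Cohen-Macaulay: the ideal
`I(a) ^ h` of the projective closure is a Cohen-Macaulay ideal. -/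
def IsArithmeticallyCohenMacaulay (K : Type*) [Field K] {n : ℕ} (a : Fin n → ℕ) : Prop :=
  IsCohenMacaulayIdeal (homogenizeIdeal (toricIdeal K a))

/-! ### Reverse lexicographic orders -/

/-- Exponent vectors in `n` variables, to be ordered by the (graded) reverse lexicographic order
for which `x_{e 0} > x_{e 1} > ⋯ > x_{e (n-1)}`. -/
def RevLexExponent {n : ℕ} (_e : Equiv.Perm (Fin n)) : Type := Fin n →₀ ℕ

namespace RevLexExponent

variable {n : ℕ} {e : Equiv.Perm (Fin n)}

instance : AddCommMonoid (RevLexExponent e) := inferInstanceAs (AddCommMonoid (Fin n →₀ ℕ))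

/-- The additive identity map to the type synonym. -/
def of (e : Equiv.Perm (Fin n)) : (Fin n →₀ ℕ) ≃+ RevLexExponent e := AddEquiv.refl _

/-- Compare total degrees first; then the exponents, from the smallest variable upwards,
the larger exponent giving the smaller monomial. -/
def key (u : RevLexExponent e) : Lex (ℕ × Lex (Fin n → ℕᵒᵈ)) :=
  toLex (((of e).symm u).degree,
    toLex fun k => OrderDual.toDual (((of e).symm u) (e (Fin.rev k))))

lemma key_injective : Function.Injective (key (e := e)) := by
  intro u v h
  have h2 := congrArg (fun p => ofLex (ofLex p).2) h
  have h3 : ∀ i, (of e).symm u i = (of e).symm v i := by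
    intro i
    have := congrFun h2 (Fin.rev (e.symm i))
    simpa [key] using this
  exact (of e).symm.injective (Finsupp.ext h3)

instance : LinearOrder (RevLexExponent e) := LinearOrder.lift' key key_injective

lemma lt_iff (u v : Fin n →₀ ℕ) : of e u < of e v ↔
    u.degree < v.degree ∨ u.degree = v.degree ∧
      ∃ k, v (e k) < u (e k) ∧ ∀ j, k < j → u (e j) = v (e j) := by
  change key (of e u) < key (of e v) ↔ _
  simp only [key, Prod.Lex.toLex_lt_toLex, AddEquiv.symm_apply_apply]
  refine or_congr Iff.rfl (and_congr Iff.rfl ?_)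
  constructor
  · rintro ⟨k, h1, h2⟩
    refine ⟨Fin.rev k, h2, fun j hj => ?_⟩
    have := h1 (Fin.rev j) (Fin.rev_lt_iff.1 hj)
    simpa using this
  · rintro ⟨k, h1, h2⟩
    refine ⟨Fin.rev k, fun j hj => ?_, by simpa using h1⟩
    have := h2 (Fin.rev j) (Fin.lt_rev_iff.1 hj)
    simpa using this

instance : IsOrderedAddMonoid (RevLexExponent e) where
  add_le_add_left u v h w := by
    obtain ⟨u, rfl⟩ := (of e).surjective u
    obtain ⟨v, rfl⟩ := (of e).surjective v
    obtain ⟨w, rfl⟩ := (of e).surjective w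
    rcases h.lt_or_eq with h | h
    · refine le_of_lt ?_
      rw [← map_add, ← map_add]
      rw [lt_iff] at h ⊢
      simpa [map_add] using h
    · rw [h]

lemma of_monotone : Monotone (of e) := by
  intro u v h
  by_contra! hlt
  rw [lt_iff] at hlt
  obtain ⟨w, rfl⟩ := exists_add_of_le h
  rcases hlt with hd | ⟨hd, k, hk, -⟩
  · simp [map_add] at hd
  · have hw : w = 0 := by
      have : w.degree = 0 := by simpa [map_add] using hd
      exact (Finsupp.degree_eq_zero_iff w).1 this
    simp [hw] at hk

instance : WellFoundedLT (RevLexExponent e) := by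
  have h1 : (Set.univ : Set (Fin n →₀ ℕ)).IsPWO := Set.isPWO_of_wellQuasiOrderedLE _
  have h2 := h1.image_of_monotone (of_monotone (e := e))
  rw [Set.image_univ, (of e).surjective.range_eq] at h2
  exact ⟨Set.wellFoundedOn_univ.1 h2.isWF⟩

end RevLexExponent

/-- The (graded) reverse lexicographic order on the monomials in `n` variables for which
`x_{e 0} > x_{e 1} > ⋯ > x_{e (n-1)}`. -/
def revLex {n : ℕ} (e : Equiv.Perm (Fin n)) : MonomialOrder (Fin n) where
  syn := RevLexExponent e
  toSyn := RevLexExponent.of e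
  toSyn_monotone := RevLexExponent.of_monotone

open scoped MonomialOrder in
/-- `x ^ u < x ^ v` if and only if `x ^ u` has smaller total degree, or the degrees agree and, at the
smallest variable at which the exponents differ, `u` has the larger exponent. -/
lemma revLex_lt_iff {n : ℕ} (e : Equiv.Perm (Fin n)) (u v : Fin n →₀ ℕ) :
    u ≺[revLex e] v ↔ u.degree < v.degree ∨ u.degree = v.degree ∧
      ∃ k, v (e k) < u (e k) ∧ ∀ j, k < j → u (e j) = v (e j) :=
  RevLexExponent.lt_iff u v

/-! ### Initial ideals -/

/-- The initial ideal of `I`: generated by the initial monomials of the nonzero elements of `I`. -/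
def initialIdeal {K : Type*} [Field K] {n : ℕ} (m : MonomialOrder (Fin n))
    (I : Ideal (MvPolynomial (Fin n) K)) : Ideal (MvPolynomial (Fin n) K) :=
  Ideal.span ((fun f => monomial (m.degree f) (1 : K)) '' {f | f ∈ I ∧ f ≠ 0})

/-- The exponents of the monomials in `J` that are minimal with respect to divisibility. For a
monomial ideal `J` these monomials form its unique minimal set of monomial generators `G(J)`. -/
def minimalMonomialGenerators {K : Type*} [Field K] {n : ℕ} (J : Ideal (MvPolynomial (Fin n) K)) :
    Set (Fin n →₀ ℕ) :=
  {u | Minimal (fun v => monomial v (1 : K) ∈ J) u}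

end MonomialCurve

end

namespace MonomialCurve

open MvPolynomial

/-! ### Counting minimal elements of an upper set with small complement -/

/-! Write x_l for the variable of largest weight, which is also the smallest variable. The toric
ideal is spanned by binomials, so a monomial is initial exactly when a smaller monomial has the same
weight (`monomial_mem_initialIdeal_iff`).

The geometric input is `mem_initialExponents_of_add_single`: x_l is a nonzerodivisor modulo the
initial ideal. Let x^v be smaller than x^w x_l, of equal weight. If the degrees agree, x_l divides
x^v by reverse lexicographic comparison and cancels. Otherwise x_0^d x^v = x^w x_l on the affine
cone. Powers of all the variables then multiply x^v into (x_l). At the vertex the cone is a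
Cohen-Macaulay domain of dimension at least two, so x_l divides x^v locally; comparing bidegrees
gives a monomial multiple of x_l with the bidegree of x^v
(`exists_add_single_of_isArithmeticallyCohenMacaulay`).

Hence minimal generators avoid x_l, and standard monomials avoiding x_l have distinct weights modulo
a_l (`exists_finset_standard`), so there are at most a_l of them. The rest is a count in m = n - 1
variables (`encard_minimal_le_choose`): a minimal generator has degree two or is a variable times a
standard monomial of degree at least two. -/

lemma choose_two_add_mul_le_choose {m : ℕ} (hm : 3 ≤ m) (k : ℕ) :
    (m + 1).choose 2 + m * k ≤ (m + 1 + k).choose (m - 1) := by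
  obtain ⟨r, rfl⟩ : ∃ r, m = r + 3 := ⟨m - 3, by omega⟩
  induction k with
  | zero =>
    rw [← Nat.choose_symm_of_eq_add (show r + 3 + 1 = (r + 3 - 1) + 2 by omega)]
    simp
  | succ k ih =>
    -- By Pascal's rule the right side grows by this binomial coefficient when `k` increases by one,
    -- while the left side grows by `m = r + 3`. For `m = 2` the growth would only be 1, whence the
    -- bound on `m`.
    have h : r + 3 ≤ (r + 3 + 1 + k).choose (r + 1) := by
      have h1 : (r + 2).choose (r + 1) ≤ (r + 1 + 2 + k).choose (r + 1) :=
        Nat.choose_le_choose _ (by omega)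
      calc r + 3 = (r + 3).choose (r + 2) := by
            rw [Nat.choose_succ_self_right]
        _ = (r + 2).choose (r + 1) + (r + 2).choose (r + 2) := Nat.choose_succ_succ _ _
        _ ≤ (r + 3 + k).choose (r + 1) + (r + 3 + k).choose r := by
            refine Nat.add_le_add (Nat.choose_le_choose _ (by omega)) ?_
            rw [Nat.choose_self]
            exact Nat.choose_pos (by omega)
        _ = (r + 3 + 1 + k).choose (r + 1) := by
            rw [show r + 3 + 1 + k = (r + 3 + k) + 1 by omega, Nat.choose_succ_succ, add_comm]
    have e : (r + 3 + 1 + (k + 1)).choose (r + 3 - 1) =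
        (r + 3 + 1 + k).choose (r + 1) + (r + 3 + 1 + k).choose (r + 3 - 1) := by
      rw [show r + 3 + 1 + (k + 1) = (r + 3 + 1 + k) + 1 by omega,
        show r + 3 - 1 = (r + 1) + 1 by omega, Nat.choose_succ_succ]
    rw [e, mul_add, mul_one]
    omega

section Minimal

open Finsupp

variable {σ : Type*} {L : Set (σ →₀ ℕ)}

lemma exists_add_single_of_pos {u : σ →₀ ℕ} {i : σ} (hi : u i ≠ 0) :
    ∃ b, u = b + single i 1 := by
  have h : single i 1 ≤ u := single_le_iff.2 (Nat.one_le_iff_ne_zero.2 hi)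
  exact ⟨u - single i 1, (tsub_add_cancel_of_le h).symm⟩

lemma notMem_of_eq_add_single {u b : σ →₀ ℕ} {i : σ} (hu : Minimal (· ∈ L) u)
    (h : u = b + single i 1) : b ∉ L := by
  intro hb
  have h1 := hu.2 hb (by simp [h])
  have h2 := h1 i
  simp [h] at h2

lemma support_subset_of_add {u b c : σ →₀ ℕ} {s : Finset σ} (h : u = b + c)
    (hu : u.support ⊆ s) : b.support ⊆ s := by
  subst h
  exact (support_mono (by simp)).trans hu

/-- At most one minimal element of `L` involves a single prescribed variable. -/
lemma subsingleton_minimal_single (i : σ) :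
    {u | Minimal (· ∈ L) u ∧ u.support ⊆ {i}}.Subsingleton := by
  rintro u ⟨hu, hui⟩ v ⟨hv, hvi⟩
  obtain ⟨p, rfl⟩ := support_subset_singleton'.1 hui
  obtain ⟨q, rfl⟩ := support_subset_singleton'.1 hvi
  rcases le_total p q with h | h
  · exact hv.eq_of_le hu.1 (single_le_single.2 h)
  · exact (hu.eq_of_le hv.1 (single_le_single.2 h)).symm

lemma exists_eq_single_add_single {u : σ →₀ ℕ} (hu : u.degree = 2) :
    ∃ i j, u = single i 1 + single j 1 := by
  obtain ⟨i, hi⟩ : ∃ i, u i ≠ 0 := by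
    by_contra! h
    have : u = 0 := Finsupp.ext h
    simp [this] at hu
  obtain ⟨b, rfl⟩ := exists_add_single_of_pos hi
  have hb : b.degree = 1 := by simpa [map_add] using hu
  obtain ⟨j, hj⟩ : ∃ i, b i ≠ 0 := by
    by_contra! h
    have : b = 0 := Finsupp.ext h
    simp [this] at hb
  obtain ⟨c, rfl⟩ := exists_add_single_of_pos hj
  have hc : c = 0 := (Finsupp.degree_eq_zero_iff c).1 (by simpa [map_add] using hb)
  exact ⟨j, i, by simp [hc]⟩

lemma two_le_degree_of_mem (h0 : 0 ∉ L) (h1 : ∀ i, single i 1 ∉ L) {u : σ →₀ ℕ} (hu : u ∈ L) :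
    2 ≤ u.degree := by
  obtain ⟨i, hi⟩ : ∃ i, u i ≠ 0 := by
    by_contra! h
    have : u = 0 := Finsupp.ext h
    exact h0 (this ▸ hu)
  obtain ⟨b, rfl⟩ := exists_add_single_of_pos hi
  by_contra! h
  have hb : b = 0 := (Finsupp.degree_eq_zero_iff b).1 (by
    simp only [map_add, degree_single] at h; omega)
  exact h1 i (by simpa [hb] using hu)

variable [DecidableEq σ] {s : Finset σ} {B : Finset (σ →₀ ℕ)}

/-- The monomial 1 and the variables indexed by `s` lie in `B` and have degree at most one. -/
lemma card_filter_two_le_degree (hB : ∀ v, v ∈ B ↔ v ∉ L ∧ v.support ⊆ s)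
    (h0 : 0 ∉ L) (h1 : ∀ i, single i 1 ∉ L) :
    (B.filter (2 ≤ ·.degree)).card + (s.card + 1) ≤ B.card := by
  have hinj : Function.Injective fun i : σ => single i (1 : ℕ) :=
    Finsupp.single_left_injective one_ne_zero
  have hc : (insert 0 (s.image fun i => single i (1 : ℕ))).card = s.card + 1 := by
    rw [Finset.card_insert_of_notMem (by simp), Finset.card_image_of_injective _ hinj]
  rw [← hc, ← Finset.card_union_of_disjoint]
  · refine Finset.card_le_card (Finset.union_subset (Finset.filter_subset _ _) ?_)
    intro v hv
    rw [Finset.mem_insert, Finset.mem_image] at hv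
    rw [hB]
    rcases hv with rfl | ⟨i, hi, rfl⟩
    · exact ⟨h0, by simp⟩
    · exact ⟨h1 i, support_single_subset.trans (by simpa using hi)⟩
  · rw [Finset.disjoint_right]
    intro v hv
    rw [Finset.mem_insert, Finset.mem_image] at hv
    rcases hv with rfl | ⟨i, hi, rfl⟩ <;> simp

/-- The minimal elements of degree two are sums of two unit vectors, the others are obtained from
elements of degree at least two outside `L` by adding a unit vector. -/
lemma encard_minimal_le_choose_two_add (hB : ∀ v, v ∈ B ↔ v ∉ L ∧ v.support ⊆ s)
    (h0 : 0 ∉ L) (h1 : ∀ i, single i 1 ∉ L)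
    (hG : ∀ u, Minimal (· ∈ L) u → u.support ⊆ s) :
    {u | Minimal (· ∈ L) u}.encard ≤
      ((s.card + 1).choose 2 + s.card * (B.filter (2 ≤ ·.degree)).card : ℕ) := by
  let F₂ : Finset (σ →₀ ℕ) := s.sym2.image
    (Sym2.lift ⟨fun i j => single i 1 + single j 1, fun i j => add_comm _ _⟩)
  let F₃ : Finset (σ →₀ ℕ) := (s ×ˢ B.filter (2 ≤ ·.degree)).image fun p => p.2 + single p.1 1
  have hsub : {u | Minimal (· ∈ L) u} ⊆ ((F₂ ∪ F₃ : Finset (σ →₀ ℕ)) : Set (σ →₀ ℕ)) := by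
    intro u hu
    have hd := two_le_degree_of_mem h0 h1 hu.1
    have hus := hG u hu
    rw [Finset.mem_coe, Finset.mem_union]
    rcases hd.eq_or_lt with hd | hd
    · left
      obtain ⟨i, j, rfl⟩ := exists_eq_single_add_single hd.symm
      refine Finset.mem_image.2 ⟨s(i, j), Finset.mk_mem_sym2_iff.2 ⟨?_, ?_⟩, rfl⟩
      · exact hus (by simp)
      · exact hus (by simp)
    · right
      obtain ⟨i, hi⟩ : ∃ i, u i ≠ 0 := by
        by_contra! h
        have : u = 0 := Finsupp.ext h
        simp [this] at hd
      obtain ⟨b, hb⟩ := exists_add_single_of_pos hi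
      have hbd : 2 ≤ b.degree := by
        have := congrArg Finsupp.degree hb
        simp only [map_add, degree_single] at this
        omega
      refine Finset.mem_image.2 ⟨(i, b), Finset.mem_product.2 ⟨hus (by simpa using hi),
        Finset.mem_filter.2 ⟨(hB b).2 ⟨notMem_of_eq_add_single hu hb,
          support_subset_of_add hb hus⟩, hbd⟩⟩, hb.symm⟩
  refine (Set.encard_le_encard hsub).trans ?_
  rw [Set.encard_coe_eq_coe_finsetCard, Nat.cast_le]
  refine (Finset.card_union_le _ _).trans (Nat.add_le_add ?_ ?_)
  · exact Finset.card_image_le.trans (Finset.card_sym2 s).le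
  · exact Finset.card_image_le.trans (Finset.card_product _ _).le

/-- In two variables, all minimal elements but one arise from nonzero elements outside `L` by
adding a fixed unit vector. -/
lemma encard_minimal_le_card {i j : σ} (hij : i ≠ j)
    (hB : ∀ v, v ∈ B ↔ v ∉ L ∧ v.support ⊆ {i, j})
    (h0 : 0 ∉ L) (h1 : ∀ i, single i 1 ∉ L)
    (hG : ∀ u, Minimal (· ∈ L) u → u.support ⊆ {i, j}) :
    {u | Minimal (· ∈ L) u}.encard ≤ B.card := by
  have hsub : {u | Minimal (· ∈ L) u} ⊆ {u | Minimal (· ∈ L) u ∧ u.support ⊆ {i}} ∪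
      (((B.erase 0).image (· + single j 1) : Finset (σ →₀ ℕ)) : Set (σ →₀ ℕ)) := by
    intro u hu
    have hus := hG u hu
    by_cases hj : u j = 0
    · left
      refine ⟨hu, fun k hk => ?_⟩
      have := hus hk
      rw [Finset.mem_insert, Finset.mem_singleton] at this
      rcases this with rfl | rfl
      · simp
      · simp [hj] at hk
    · right
      obtain ⟨b, hb⟩ := exists_add_single_of_pos hj
      refine Finset.mem_coe.2 (Finset.mem_image.2 ⟨b, Finset.mem_erase.2 ⟨?_, (hB b).2
        ⟨notMem_of_eq_add_single hu hb, support_subset_of_add hb hus⟩⟩, hb.symm⟩)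
      rintro rfl
      exact h1 j (by simpa [hb] using hu.1)
  refine (Set.encard_le_encard hsub).trans ((Set.encard_union_le _ _).trans ?_)
  have hs := Set.encard_le_one_iff_subsingleton.2 (subsingleton_minimal_single (L := L) i)
  have h0B : 0 ∈ B := (hB 0).2 ⟨h0, by simp⟩
  have hc := Finset.card_erase_add_one h0B
  rw [Set.encard_coe_eq_coe_finsetCard, ← hc, add_comm, Nat.cast_add, Nat.cast_one]
  exact add_le_add (by exact_mod_cast Finset.card_image_le) hs

/-- A set of monomials in `m ≥ 1` variables without constants and variables, whose complement has
at most `a` elements, has at most `a.choose (m - 1)` minimal elements. -/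
theorem encard_minimal_le_choose (hs : s.Nonempty)
    (hB : ∀ v, v ∈ B ↔ v ∉ L ∧ v.support ⊆ s)
    (h0 : 0 ∉ L) (h1 : ∀ i, single i 1 ∉ L)
    (hG : ∀ u, Minimal (· ∈ L) u → u.support ⊆ s) {a : ℕ} (ha : B.card ≤ a) :
    {u | Minimal (· ∈ L) u}.encard ≤ (a.choose (s.card - 1) : ℕ) := by
  have hcard := card_filter_two_le_degree hB h0 h1
  have hpos := hs.card_pos
  -- The general count is too weak for two variables, and for one variable the target is `a.choose 0
  -- = 1`; both cases are treated directly.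
  obtain hm | hm | hm : s.card = 1 ∨ s.card = 2 ∨ 3 ≤ s.card := by omega
  · obtain ⟨i, rfl⟩ := Finset.card_eq_one.1 hm
    have : {u | Minimal (· ∈ L) u} ⊆ {u | Minimal (· ∈ L) u ∧ u.support ⊆ {i}} :=
      fun u hu => ⟨hu, hG u hu⟩
    refine (Set.encard_le_encard this).trans ?_
    simpa using Set.encard_le_one_iff_subsingleton.2 (subsingleton_minimal_single (L := L) i)
  · obtain ⟨i, j, hij, rfl⟩ := Finset.card_eq_two.1 hm
    refine (encard_minimal_le_card hij hB h0 h1 hG).trans ?_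
    rw [hm, Nat.choose_one_right]
    exact_mod_cast ha
  · refine (encard_minimal_le_choose_two_add hB h0 h1 hG).trans ?_
    rw [Nat.cast_le]
    refine (choose_two_add_mul_le_choose hm _).trans (Nat.choose_le_choose _ ?_)
    omega

end Minimal

/-! ### Regular sequences of length two -/

section Regular

variable {R : Type*} [CommRing R]

/-- This is injectivity of multiplication by `r₂` on R/(r₁), written with elements. -/
lemma exists_eq_mul_of_isWeaklyRegular {r₁ r₂ : R} {rs : List R}
    (h : RingTheory.Sequence.IsWeaklyRegular R (r₁ :: r₂ :: rs)) {x y : R}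
    (hxy : r₂ * x = r₁ * y) : ∃ z, x = r₁ * z := by
  rw [RingTheory.Sequence.isWeaklyRegular_cons_iff,
    RingTheory.Sequence.isWeaklyRegular_cons_iff] at h
  have hinj := h.2.1
  have hx : (Submodule.Quotient.mk x : QuotSMulTop r₁ R) = 0 := by
    apply hinj
    simp only [smul_zero]
    rw [← Submodule.Quotient.mk_smul, Submodule.Quotient.mk_eq_zero, smul_eq_mul, hxy]
    exact Submodule.smul_mem_pointwise_smul _ _ _ trivial
  rw [Submodule.Quotient.mk_eq_zero] at hx
  obtain ⟨z, -, hz⟩ := (Submodule.mem_smul_pointwise_iff_exists _ _ _).1 hx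
  exact ⟨z, by simpa using hz.symm⟩

variable [IsDomain R] {r₁ r₂ : R}

/-- Peel off the factors `r₂` with a single `r₁` on the right, then the factors `r₁`, cancelling one
at each step in the domain. -/
lemma exists_eq_pow_mul (h₁ : r₁ ≠ 0) (h : ∀ x y, r₂ * x = r₁ * y → ∃ z, x = r₁ * z) (j k : ℕ) :
    ∀ x y, r₂ ^ k * x = r₁ ^ j * y → ∃ z, x = r₁ ^ j * z := by
  have hk : ∀ k x y, r₂ ^ k * x = r₁ * y → ∃ z, x = r₁ * z := by
    intro k
    induction k with
    | zero => intro x y hxy; exact ⟨y, by simpa using hxy⟩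
    | succ k ih =>
      intro x y hxy
      obtain ⟨z, hz⟩ := h (r₂ ^ k * x) y (by rw [← hxy]; ring)
      exact ih x z hz
  induction j with
  | zero => intro x y _; exact ⟨x, by simp⟩
  | succ j ih =>
    intro x y hxy
    obtain ⟨z, rfl⟩ := hk k x (r₁ ^ j * y) (by rw [hxy]; ring)
    obtain ⟨w, rfl⟩ := ih z y (mul_left_cancel₀ h₁ (by
      calc r₁ * (r₂ ^ k * z) = r₂ ^ k * (r₁ * z) := by ring
        _ = r₁ * (r₁ ^ j * y) := by rw [hxy]; ring))
    exact ⟨w, by ring⟩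

/-- If a domain has a regular sequence of length two in an ideal `M`, then a principal ideal does
not have an `M`-primary colon ideal `((x) : y)`, unless that is the unit ideal. -/
lemma dvd_of_isWeaklyRegular {rs : List R}
    (h : RingTheory.Sequence.IsWeaklyRegular R (r₁ :: r₂ :: rs)) {x y : R}
    {k₁ k₂ : ℕ} (h₁ : x ∣ r₁ ^ k₁ * y) (h₂ : x ∣ r₂ ^ k₂ * y) : x ∣ y := by
  have h0 : r₁ ≠ 0 := by
    rintro rfl
    have := (RingTheory.Sequence.isWeaklyRegular_cons_iff R _ _).1 h
    exact one_ne_zero (this.1 (by simp : (0 : R) • (1 : R) = (0 : R) • (0 : R)))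
  by_cases hx : x = 0
  · subst hx
    rw [zero_dvd_iff] at h₁ ⊢
    exact (mul_eq_zero.1 h₁).resolve_left (pow_ne_zero _ h0)
  obtain ⟨w, hw⟩ := h₁
  obtain ⟨w', hw'⟩ := h₂
  -- Multiplying the two divisibilities crosswise and cancelling `x` gives r₂^k₂ w = r₁^k₁ w', so
  -- `w` is divisible by r₁^k₁, which can then be cancelled against `y`.
  obtain ⟨z, rfl⟩ := exists_eq_pow_mul h0 (fun _ _ => exists_eq_mul_of_isWeaklyRegular h) k₁ k₂ w w'
    (mul_left_cancel₀ hx (by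
      calc x * (r₂ ^ k₂ * w) = r₂ ^ k₂ * (x * w) := by ring
        _ = r₂ ^ k₂ * (r₁ ^ k₁ * y) := by rw [hw]
        _ = r₁ ^ k₁ * (r₂ ^ k₂ * y) := by ring
        _ = x * (r₁ ^ k₁ * w') := by rw [hw']; ring))
  exact ⟨z, mul_left_cancel₀ (pow_ne_zero k₁ h0) (by rw [hw]; ring)⟩

end Regular

/-! ### The toric ideal and its initial ideal -/

section Toric

variable {K : Type*} [Field K] {n : ℕ} (a : Fin n → ℕ)

lemma aeval_X_pow_monomial (u : Fin n →₀ ℕ) (c : K) :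
    aeval (fun i => (Polynomial.X : Polynomial K) ^ a i) (monomial u c) =
      Polynomial.monomial (Finsupp.weight a u) c := by
  rw [aeval_monomial, ← Polynomial.C_mul_X_pow_eq_monomial, Finsupp.weight_apply, Finsupp.prod,
    Finsupp.sum, ← Finset.prod_pow_eq_pow_sum]
  simp only [← pow_mul, smul_eq_mul, mul_comm]
  rfl

lemma coeff_aeval_X_pow (f : MvPolynomial (Fin n) K) (d : ℕ) :
    (aeval (fun i => (Polynomial.X : Polynomial K) ^ a i) f).coeff d =
      ∑ u ∈ f.support with Finsupp.weight a u = d, coeff u f := by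
  conv_lhs => rw [f.as_sum]
  simp only [map_sum, aeval_X_pow_monomial, Polynomial.finsetSum_coeff, Polynomial.coeff_monomial]
  rw [Finset.sum_filter]

lemma monomial_sub_monomial_mem_toricIdeal {u v : Fin n →₀ ℕ}
    (h : Finsupp.weight a u = Finsupp.weight a v) :
    monomial u (1 : K) - monomial v 1 ∈ toricIdeal K a := by
  rw [toricIdeal, RingHom.mem_ker, map_sub]
  erw [aeval_X_pow_monomial, aeval_X_pow_monomial]
  rw [h, sub_self]

open scoped MonomialOrder

/-- The exponents `v` such that some smaller monomial has the same weight. -/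
def initialExponents (m : MonomialOrder (Fin n)) : Set (Fin n →₀ ℕ) :=
  {v | ∃ w, w ≺[m] v ∧ Finsupp.weight a w = Finsupp.weight a v}

variable {a} {m : MonomialOrder (Fin n)}

lemma add_mem_initialExponents {v : Fin n →₀ ℕ} (hv : v ∈ initialExponents a m)
    (p : Fin n →₀ ℕ) : v + p ∈ initialExponents a m := by
  obtain ⟨w, hw, h⟩ := hv
  refine ⟨w + p, ?_, by rw [map_add, map_add, h]⟩
  rw [map_add, map_add]
  exact add_lt_add_left hw _

/-- Without a smaller monomial of the same weight, the leading coefficient would be the only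
contribution to its power of t in the image of `f`, which is zero. -/
lemma degree_mem_initialExponents {f : MvPolynomial (Fin n) K} (hf : f ∈ toricIdeal K a)
    (hf0 : f ≠ 0) : m.degree f ∈ initialExponents a m := by
  have h := coeff_aeval_X_pow a f (Finsupp.weight a (m.degree f))
  rw [toricIdeal, RingHom.mem_ker] at hf
  erw [hf] at h
  rw [Polynomial.coeff_zero] at h
  by_contra hno
  have : ({u ∈ f.support | Finsupp.weight a u = Finsupp.weight a (m.degree f)} : Finset _) =
      {m.degree f} := by
    ext u
    rw [Finset.mem_filter, Finset.mem_singleton]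
    constructor
    · rintro ⟨hu, hw⟩
      by_contra hne
      exact hno ⟨u, lt_of_le_of_ne (m.le_degree hu) fun h => hne (m.toSyn.injective h), hw⟩
    · rintro rfl
      exact ⟨m.degree_mem_support hf0, rfl⟩
  rw [this, Finset.sum_singleton] at h
  exact (m.coeff_degree_ne_zero_iff.2 hf0) h.symm

variable (K a m) in
lemma initialIdeal_toricIdeal : initialIdeal m (toricIdeal K a) =
    Ideal.span ((fun v => monomial v (1 : K)) '' initialExponents a m) := by
  rw [initialIdeal]
  congr 1
  ext f
  constructor
  · rintro ⟨g, ⟨hg, hg0⟩, rfl⟩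
    exact ⟨_, degree_mem_initialExponents hg hg0, rfl⟩
  · rintro ⟨v, ⟨w, hwv, hw⟩, rfl⟩
    have hd : m.degree (monomial v (1 : K) - monomial w 1) = v := by
      classical
      rw [m.degree_sub_of_lt] <;> simp [m.degree_monomial, hwv]
    refine ⟨monomial v 1 - monomial w 1,
      ⟨monomial_sub_monomial_mem_toricIdeal a hw.symm, ?_⟩, ?_⟩
    · rw [sub_ne_zero]
      intro h
      have := (monomial_left_inj (one_ne_zero (α := K))).1 h
      exact hwv.ne (this ▸ rfl)
    · simp only [hd]

lemma monomial_mem_initialIdeal_iff {v : Fin n →₀ ℕ} :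
    monomial v (1 : K) ∈ initialIdeal m (toricIdeal K a) ↔ v ∈ initialExponents a m := by
  classical
  rw [initialIdeal_toricIdeal, mem_ideal_span_monomial_image]
  simp only [support_monomial, one_ne_zero, if_false, Finset.mem_singleton, forall_eq]
  constructor
  · rintro ⟨u, hu, huv⟩
    obtain ⟨p, rfl⟩ := exists_add_of_le huv
    exact add_mem_initialExponents hu p
  · intro h
    exact ⟨v, h, le_rfl⟩

lemma minimalMonomialGenerators_eq : minimalMonomialGenerators (initialIdeal m (toricIdeal K a)) =
    {u | Minimal (· ∈ initialExponents a m) u} := by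
  ext u
  simp only [minimalMonomialGenerators, monomial_mem_initialIdeal_iff]

variable (K a m) in
lemma initialIdeal_eq_span_minimal : initialIdeal m (toricIdeal K a) =
    Ideal.span ((fun v => monomial v (1 : K)) ''
      minimalMonomialGenerators (initialIdeal m (toricIdeal K a))) := by
  rw [minimalMonomialGenerators_eq, initialIdeal_toricIdeal]
  refine le_antisymm (Ideal.span_le.2 ?_) (Ideal.span_mono (Set.image_mono fun u hu => hu.1))
  rintro _ ⟨v, hv, rfl⟩
  obtain ⟨u, huv, hu⟩ := exists_minimal_le_of_wellFoundedLT (· ∈ initialExponents a m) v hv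
  obtain ⟨p, rfl⟩ := exists_add_of_le huv
  have : monomial (u + p) (1 : K) = monomial p 1 * monomial u 1 := by
    rw [monomial_mul, add_comm, one_mul]
  simp only [this]
  exact Ideal.mul_mem_left _ _ (Ideal.subset_span ⟨u, hu, rfl⟩)

end Toric

/-! ### The homogenization of the toric ideal -/

section Homogenization

variable (K : Type*) [Field K] {n : ℕ} (a : Fin n → ℕ)

/-- The weights `0, a_1, …, a_n` of the variables `x_0, x_1, …, x_n`. -/
def coneExponent : Fin (n + 1) → ℕ := Fin.cons 0 a

/-- The parametrization `x_i ↦ t ^ a_i s` of the affine cone over the projective monomial curve,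
where `a_0 = 0`. -/
noncomputable def coneParam : MvPolynomial (Fin (n + 1)) K →ₐ[K] Polynomial (Polynomial K) :=
  aeval fun i => Polynomial.monomial 1 ((Polynomial.X : Polynomial K) ^ coneExponent a i)

/-- The weight of the exponent vectors in `x_0, …, x_n`, where `x_0` has weight zero. -/
noncomputable abbrev coneWeight : (Fin (n + 1) →₀ ℕ) →+ ℕ := Finsupp.weight (coneExponent a)

variable {K}

lemma coneParam_monomial (u : Fin (n + 1) →₀ ℕ) (c : K) :
    coneParam K a (monomial u c) =
      Polynomial.monomial u.degree (Polynomial.monomial (coneWeight a u) c) := by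
  rw [coneParam, aeval_monomial]
  simp only [Polynomial.monomial_pow, one_mul, ← pow_mul]
  have : ∀ s : Finset (Fin (n + 1)), ∏ i ∈ s, Polynomial.monomial (u i)
      ((Polynomial.X : Polynomial K) ^ (coneExponent a i * u i)) =
      Polynomial.monomial (∑ i ∈ s, u i)
        (Polynomial.X ^ (∑ i ∈ s, coneExponent a i * u i)) := by
    intro s
    induction s using Finset.induction_on with
    | empty => simp
    | insert i s hi ih =>
      rw [Finset.prod_insert hi, Finset.sum_insert hi, Finset.sum_insert hi, ih,
        Polynomial.monomial_mul_monomial, ← pow_add]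
  rw [Finsupp.prod, this, Finsupp.degree_apply, Finsupp.weight_apply, Finsupp.sum,
    ← Polynomial.C_mul_X_pow_eq_monomial (n := ∑ _ ∈ _, _ • _)]
  simp only [smul_eq_mul, mul_comm (u _)]
  rw [IsScalarTower.algebraMap_apply K (Polynomial K) (Polynomial (Polynomial K)),
    ← Polynomial.C_eq_algebraMap, ← Polynomial.C_eq_algebraMap, Polynomial.C_mul_monomial]

lemma coeff_coeff_coneParam (F : MvPolynomial (Fin (n + 1)) K) (D d : ℕ) :
    ((coneParam K a F).coeff D).coeff d =
      ∑ u ∈ F.support with u.degree = D ∧ coneWeight a u = d, coeff u F := by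
  conv_lhs => rw [F.as_sum]
  simp only [map_sum, coneParam_monomial, Polynomial.finsetSum_coeff, Polynomial.coeff_monomial]
  rw [Finset.sum_filter]
  refine Finset.sum_congr rfl fun u _ => ?_
  by_cases h : u.degree = D
  · simp [h, Polynomial.coeff_monomial]
  · simp [h]

lemma degree_cons (c : ℕ) (u : Fin n →₀ ℕ) : (Finsupp.cons c u).degree = c + u.degree := by
  simp [Finsupp.degree_eq_sum, Fin.sum_univ_succ]

lemma coneWeight_cons (c : ℕ) (u : Fin n →₀ ℕ) :
    coneWeight a (Finsupp.cons c u) = Finsupp.weight a u := by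
  simp [coneWeight, coneExponent, Finsupp.weight_eq_sum, Fin.sum_univ_succ]

lemma degree_le_totalDegree {σ : Type*} {f : MvPolynomial σ K} {u : σ →₀ ℕ} (hu : u ∈ f.support) :
    u.degree ≤ f.totalDegree := le_totalDegree hu

lemma coneParam_homogenize (f : MvPolynomial (Fin n) K) :
    coneParam K a (homogenize f) = Polynomial.monomial f.totalDegree
      (aeval (fun i => (Polynomial.X : Polynomial K) ^ a i) f) := by
  conv_rhs => rw [f.as_sum]
  rw [homogenize, map_sum, map_sum, map_sum]
  refine Finset.sum_congr rfl fun u hu => ?_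
  rw [coneParam_monomial, degree_cons, coneWeight_cons, aeval_X_pow_monomial,
    Nat.sub_add_cancel (degree_le_totalDegree hu), ← f.as_sum]

/-- The dehomogenization `F(1, x_1, …, x_n)`. -/
noncomputable def dehomogenize : MvPolynomial (Fin (n + 1)) K →ₐ[K] MvPolynomial (Fin n) K :=
  aeval (Fin.cons 1 X)

lemma dehomogenize_monomial (u : Fin (n + 1) →₀ ℕ) (c : K) :
    dehomogenize (monomial u c) = monomial u.tail c := by
  rw [dehomogenize, aeval_monomial, monomial_eq, Finsupp.prod_fintype _ _ (by simp),
    Finsupp.prod_fintype _ _ (by simp), Fin.prod_univ_succ]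
  simp [Finsupp.tail_apply]

lemma aeval_dehomogenize (F : MvPolynomial (Fin (n + 1)) K) :
    aeval (fun i => (Polynomial.X : Polynomial K) ^ a i) (dehomogenize F) =
      (coneParam K a F).eval 1 := by
  conv_lhs => rw [F.as_sum]
  conv_rhs => rw [F.as_sum]
  simp only [map_sum, Polynomial.eval_finsetSum, dehomogenize_monomial, aeval_X_pow_monomial,
    coneParam_monomial, Polynomial.eval_monomial, one_pow, mul_one]
  refine Finset.sum_congr rfl fun u _ => ?_
  rw [← coneWeight_cons a (u 0) u.tail, Finsupp.cons_tail]

/-- A form is recovered from its dehomogenization up to a power of `x_0`. -/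
lemma eq_X_pow_mul_homogenize {F : MvPolynomial (Fin (n + 1)) K} {D : ℕ}
    (hF : F.IsHomogeneous D) :
    F = X 0 ^ (D - (dehomogenize F).totalDegree) * homogenize (dehomogenize F) := by
  classical
  have hdeg : ∀ u ∈ F.support, u 0 + u.tail.degree = D := by
    intro u hu
    rw [← degree_cons, Finsupp.cons_tail, Finsupp.degree_eq_weight_one]
    exact hF (mem_support_iff.1 hu)
  -- In a form the exponent of x_0 is determined by the others, so setting x_0 = 1 merges no terms.
  have hinj : ∀ u ∈ F.support, ∀ v ∈ F.support, u.tail = v.tail → u = v := by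
    intro u hu v hv h
    have h0 : u 0 = v 0 := by
      have h1 := hdeg u hu
      have h2 := hdeg v hv
      rw [h] at h1
      omega
    rw [← Finsupp.cons_tail u, ← Finsupp.cons_tail v, h, h0]
  have hf : dehomogenize F = ∑ u ∈ F.support, monomial u.tail (coeff u F) := by
    conv_lhs => rw [F.as_sum]
    simp only [map_sum, dehomogenize_monomial]
  have hc : ∀ u ∈ F.support, coeff u.tail (dehomogenize F) = coeff u F := by
    intro u hu
    rw [hf, coeff_sum, Finset.sum_eq_single u]
    · simp
    · intro v hv hvu
      rw [coeff_monomial, if_neg fun h => hvu (hinj v hv u hu h)]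
    · exact fun h => absurd hu h
  have hs : (dehomogenize F).support = F.support.image Finsupp.tail := by
    ext v
    constructor
    · intro hv
      by_contra hno
      rw [mem_support_iff, hf, coeff_sum] at hv
      refine hv (Finset.sum_eq_zero fun u hu => ?_)
      rw [coeff_monomial, if_neg]
      rintro rfl
      exact hno (Finset.mem_image_of_mem _ hu)
    · rw [Finset.mem_image]
      rintro ⟨u, hu, rfl⟩
      rw [mem_support_iff, hc u hu]
      exact mem_support_iff.1 hu
  have hD : (dehomogenize F).totalDegree ≤ D := by
    refine Finset.sup_le fun v hv => ?_
    rw [hs, Finset.mem_image] at hv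
    obtain ⟨u, hu, rfl⟩ := hv
    have := hdeg u hu
    change u.tail.degree ≤ D
    omega
  rw [homogenize, hs, Finset.sum_image hinj, Finset.mul_sum]
  conv_lhs => rw [F.as_sum]
  refine Finset.sum_congr rfl fun u hu => ?_
  have h1 := hdeg u hu
  have h2 : u.tail.degree ≤ (dehomogenize F).totalDegree := by
    apply degree_le_totalDegree
    rw [hs]
    exact Finset.mem_image_of_mem _ hu
  rw [X_pow_eq_monomial, monomial_mul, one_mul, hc u hu]
  refine congrArg (fun w => monomial w (coeff u F)) (Finsupp.ext fun i => ?_)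
  refine Fin.cases ?_ (fun j => ?_) i
  · simp
    omega
  · simp [Finsupp.tail_apply, Fin.succ_ne_zero]

/-- The outer variable of the target records the total degree; hence the kernel of `coneParam` is a
homogeneous ideal. -/
lemma coneParam_homogeneousComponent (F : MvPolynomial (Fin (n + 1)) K) (D : ℕ) :
    coneParam K a (homogeneousComponent D F) =
      Polynomial.monomial D ((coneParam K a F).coeff D) := by
  classical
  rw [homogeneousComponent_apply]
  conv_rhs => rw [F.as_sum]
  simp only [map_sum, coneParam_monomial, Polynomial.finsetSum_coeff, Polynomial.coeff_monomial]
  rw [Finset.sum_filter]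
  refine Finset.sum_congr rfl fun u _ => ?_
  split_ifs with h
  · rw [h]
  · simp

variable (K) in
-- The kernel is homogeneous, and a form in it is a power of x_0 times the homogenization of its
-- dehomogenization, which lies in the toric ideal because setting x_0 = 1 amounts to setting s = 1.
-- In particular the ideal is prime.
theorem homogenizeIdeal_toricIdeal :
    homogenizeIdeal (toricIdeal K a) = RingHom.ker (coneParam K a) := by
  refine le_antisymm (Ideal.span_le.2 ?_) fun F hF => ?_
  · rintro _ ⟨f, hf, rfl⟩
    rw [SetLike.mem_coe, toricIdeal, RingHom.mem_ker] at hf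
    rw [SetLike.mem_coe, RingHom.mem_ker, coneParam_homogenize]
    erw [hf]
    simp
  · rw [RingHom.mem_ker] at hF
    rw [← sum_homogeneousComponent F]
    refine Ideal.sum_mem _ fun D _ => ?_
    have h0 : coneParam K a (homogeneousComponent D F) = 0 := by
      rw [coneParam_homogeneousComponent, hF]
      simp
    rw [eq_X_pow_mul_homogenize (homogeneousComponent_isHomogeneous D F)]
    refine Ideal.mul_mem_left _ _ (Ideal.subset_span ⟨_, ?_, rfl⟩)
    rw [SetLike.mem_coe, toricIdeal, RingHom.mem_ker]
    erw [aeval_dehomogenize, h0]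
    simp

end Homogenization

/-! ### The Cohen-Macaulay property -/

section CohenMacaulay

lemma dvd_of_isCohenMacaulayLocalRing {R : Type*} [CommRing R] [IsDomain R] [IsLocalRing R]
    (h : IsCohenMacaulayLocalRing R) (hd : 2 ≤ ringKrullDim R) {x y : R}
    (hxy : ∀ r ∈ IsLocalRing.maximalIdeal R, ∃ k : ℕ, x ∣ r ^ k * y) : x ∣ y := by
  obtain ⟨-, rs, hmem, hreg, hlen⟩ := h
  have h2 : 2 ≤ rs.length := by
    rw [← hlen] at hd
    exact_mod_cast hd
  obtain _ | ⟨r₁, _ | ⟨r₂, rs⟩⟩ := rs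
  · simp at h2
  · simp at h2
  obtain ⟨k₁, h₁⟩ := hxy r₁ (hmem _ (by simp))
  obtain ⟨k₂, h₂⟩ := hxy r₂ (hmem _ (by simp))
  exact dvd_of_isWeaklyRegular hreg.toIsWeaklyRegular h₁ h₂

lemma mem_span_X_of_constantCoeff_eq_zero {σ K : Type*} [Field K] {F : MvPolynomial σ K}
    (hF : constantCoeff F = 0) :
    F ∈ Ideal.span (Set.range (X : σ → MvPolynomial σ K)) := by
  rw [← Set.image_univ, mem_ideal_span_X_image]
  intro m hm
  by_contra! h
  have : m = 0 := Finsupp.ext fun i => h i trivial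
  rw [this, mem_support_iff] at hm
  exact hm hF

variable {K : Type*} [Field K] {n : ℕ} {a : Fin n → ℕ}

lemma constantCoeff_coeff_coneParam (F : MvPolynomial (Fin (n + 1)) K) :
    ((coneParam K a F).coeff 0).coeff 0 = constantCoeff F := by
  classical
  rw [coeff_coeff_coneParam, constantCoeff_eq]
  have : ({u ∈ F.support | u.degree = 0 ∧ coneWeight a u = 0} : Finset _) ⊆ {0} := by
    intro u hu
    rw [Finset.mem_filter] at hu
    rw [Finset.mem_singleton]
    exact (Finsupp.degree_eq_zero_iff u).1 hu.2.1
  rw [Finset.sum_subset this, Finset.sum_singleton]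
  intro u hu hu'
  rw [Finset.mem_singleton] at hu
  subst hu
  by_contra h
  exact hu' (Finset.mem_filter.2 ⟨mem_support_iff.2 h, by simp, by simp⟩)

/-- If `x_i` divides `x ^ v` in the localization of the coordinate ring of the cone at the vertex,
then some monomial divisible by `x_i` has the same image as `x ^ v` under `coneParam`. -/
lemma exists_add_single_of_coneParam_mul_eq {v : Fin (n + 1) →₀ ℕ} {i : Fin (n + 1)}
    {S G : MvPolynomial (Fin (n + 1)) K} (hS : constantCoeff S ≠ 0)
    (h : coneParam K a (monomial v 1 * S) = coneParam K a (X i * G)) :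
    ∃ p : Fin (n + 1) →₀ ℕ, (p + Finsupp.single i 1).degree = v.degree ∧
      coneWeight a (p + Finsupp.single i 1) = coneWeight a v := by
  -- Multiplication by x^v shifts bidegrees by (degree, weight) of `v`, and only the constant term
  -- of `S` has bidegree (0, 0).
  have h1 : ((coneParam K a (monomial v 1 * S)).coeff v.degree).coeff (coneWeight a v) =
      constantCoeff S := by
    rw [map_mul, coneParam_monomial, ← constantCoeff_coeff_coneParam (a := a)]
    have := Polynomial.coeff_monomial_mul (coneParam K a S) v.degree 0
      (Polynomial.monomial (coneWeight a v) (1 : K))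
    rw [zero_add] at this
    rw [this]
    have := Polynomial.coeff_monomial_mul ((coneParam K a S).coeff 0) (coneWeight a v) 0 (1 : K)
    rw [zero_add] at this
    rw [this, one_mul]
  rw [h, coeff_coeff_coneParam] at h1
  obtain ⟨u, hu, -⟩ := Finset.exists_ne_zero_of_sum_ne_zero (h1.trans_ne hS)
  rw [Finset.mem_filter, support_X_mul, Finset.mem_map] at hu
  obtain ⟨⟨p, -, rfl⟩, hd, hw⟩ := hu
  refine ⟨p, ?_, ?_⟩
  · rw [add_comm p]; exact hd
  · rw [add_comm p]; exact hw

lemma coneParam_X (i : Fin (n + 1)) : coneParam K a (X i) =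
    Polynomial.monomial 1 (Polynomial.X ^ coneExponent a i) := by
  rw [coneParam, aeval_X]

/-- The coordinate ring of the affine cone has dimension at least two at the vertex. -/
lemma two_le_height_irrelevant {Q : Ideal (MvPolynomial (Fin (n + 1)) K)} [Q.IsPrime]
    (hQ : Q = RingHom.ker (coneParam K a)) (hpos : ∀ i, a i ≠ 0) (j : Fin n)
    {ε : MvPolynomial (Fin (n + 1)) K ⧸ Q →+* K}
    (hε : ε.comp (Ideal.Quotient.mk Q) = constantCoeff) :
    2 ≤ (RingHom.ker ε).height := by
  -- Setting t = 0 in the parametrization gives a prime strictly between 0 and the vertex: it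
  -- contains the class of x_j, but not that of x_0, which maps to s.
  let ψ : MvPolynomial (Fin (n + 1)) K →+* Polynomial K :=
    (Polynomial.mapRingHom (Polynomial.constantCoeff : Polynomial K →+* K)).comp
      (coneParam K a : MvPolynomial (Fin (n + 1)) K →+* _)
  have hψQ : ∀ F ∈ Q, ψ F = 0 := by
    intro F hF
    rw [hQ, RingHom.mem_ker] at hF
    simp [ψ, hF]
  let ψ' := Ideal.Quotient.lift Q ψ hψQ
  have hψ' : ∀ F, ψ' (Ideal.Quotient.mk Q F) = ψ F := fun F => Ideal.Quotient.lift_mk _ _ _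
  have hε' : ∀ F, ε (Ideal.Quotient.mk Q F) = constantCoeff F := fun F => RingHom.congr_fun hε F
  have : (RingHom.ker ψ').IsPrime := RingHom.ker_isPrime _
  have : (RingHom.ker ε).IsPrime := RingHom.ker_isPrime _
  have : (⊥ : Ideal (MvPolynomial (Fin (n + 1)) K ⧸ Q)).IsPrime := Ideal.isPrime_bot
  have h1 : (⊥ : Ideal (MvPolynomial (Fin (n + 1)) K ⧸ Q)) < RingHom.ker ψ' := by
    refine bot_lt_iff_ne_bot.2 fun h => ?_
    have hX : Ideal.Quotient.mk Q (X j.succ) ∈ RingHom.ker ψ' := by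
      rw [RingHom.mem_ker, hψ']
      simp [ψ, coneParam_X, coneExponent, (hpos j).symm]
    rw [h, Ideal.mem_bot, Ideal.Quotient.eq_zero_iff_mem, hQ, RingHom.mem_ker, coneParam_X] at hX
    simp at hX
  have h2 : RingHom.ker ψ' < RingHom.ker ε := by
    refine lt_of_le_of_ne ?_ fun h => ?_
    · intro r hr
      obtain ⟨F, rfl⟩ := Ideal.Quotient.mk_surjective r
      rw [RingHom.mem_ker, hψ'] at hr
      rw [RingHom.mem_ker, hε', ← constantCoeff_coeff_coneParam (a := a)]
      have := congrArg (Polynomial.coeff · 0) hr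
      simpa [ψ, Polynomial.coeff_map] using this
    · have hX : Ideal.Quotient.mk Q (X 0) ∈ RingHom.ker ε := by
        rw [RingHom.mem_ker, hε', constantCoeff_X]
      rw [← h, RingHom.mem_ker, hψ'] at hX
      simp [ψ, coneParam_X, coneExponent] at hX
  have h3 := Ideal.height_add_one_le_of_lt_of_isPrime h1
  have h4 := Ideal.height_add_one_le_of_lt_of_isPrime h2
  calc (2 : ℕ∞) = 1 + 1 := by norm_num
    _ ≤ (⊥ : Ideal (MvPolynomial (Fin (n + 1)) K ⧸ Q)).height + 1 + 1 := by gcongr; simp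
    _ ≤ (RingHom.ker ψ').height + 1 := by gcongr
    _ ≤ _ := h4

/-- If the cone is Cohen-Macaulay and `a_l` is the largest weight, then `x_0` is a nonzerodivisor
modulo `x_l`. Here this is stated for monomials: if `x_0 ^ d x ^ v = x ^ q x_l` on the cone, then
`x ^ v = x ^ p x_l` for some `p`. -/
theorem exists_add_single_of_isArithmeticallyCohenMacaulay
    (hCM : IsArithmeticallyCohenMacaulay K a) (hpos : ∀ i, a i ≠ 0) {l : Fin n}
    (hl : ∀ i, a i ≤ a l) {v q : Fin (n + 1) →₀ ℕ} {d : ℕ}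
    (hd : (v + Finsupp.single 0 d).degree = (q + Finsupp.single l.succ 1).degree)
    (hw : coneWeight a v = coneWeight a (q + Finsupp.single l.succ 1)) :
    ∃ p : Fin (n + 1) →₀ ℕ, (p + Finsupp.single l.succ 1).degree = v.degree ∧
      coneWeight a (p + Finsupp.single l.succ 1) = coneWeight a v := by
  rw [IsArithmeticallyCohenMacaulay, IsCohenMacaulayIdeal] at hCM
  have hQ := homogenizeIdeal_toricIdeal K a
  generalize homogenizeIdeal (toricIdeal K a) = Q at hCM hQ
  have : Q.IsPrime := hQ ▸ RingHom.ker_isPrime _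
  have hmk : ∀ F G, Ideal.Quotient.mk Q F = Ideal.Quotient.mk Q G ↔
      coneParam K a F = coneParam K a G := by
    intro F G
    rw [Ideal.Quotient.eq, hQ, RingHom.mem_ker, map_sub, sub_eq_zero]
  have hcQ : ∀ F ∈ Q, constantCoeff F = 0 := by
    intro F hF
    rw [hQ, RingHom.mem_ker] at hF
    rw [← constantCoeff_coeff_coneParam (a := a), hF]
    simp
  let ε : MvPolynomial (Fin (n + 1)) K ⧸ Q →+* K := Ideal.Quotient.lift Q constantCoeff hcQ
  have hε : ε.comp (Ideal.Quotient.mk Q) = constantCoeff := by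
    ext <;> simp [ε]
  have hε' : ∀ F, ε (Ideal.Quotient.mk Q F) = constantCoeff F := fun F => RingHom.congr_fun hε F
  have hsurj : Function.Surjective ε := fun c => ⟨Ideal.Quotient.mk Q (C c), by simp [hε']⟩
  have hM : (RingHom.ker ε).IsMaximal := RingHom.ker_isMaximal_of_surjective ε hsurj
  let R := MvPolynomial (Fin (n + 1)) K ⧸ Q
  let A := Localization.AtPrime (RingHom.ker ε)
  have hle : (RingHom.ker ε).primeCompl ≤ nonZeroDivisors R := Ideal.primeCompl_le_nonZeroDivisors _
  have : IsDomain A := IsLocalization.isDomain_localization hle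
  have hinj : Function.Injective (algebraMap R A) := IsLocalization.injective A hle
  have hdim : 2 ≤ ringKrullDim A := by
    rw [IsLocalization.AtPrime.ringKrullDim_eq_height (RingHom.ker ε) A]
    exact WithBot.coe_le_coe.2 (two_le_height_irrelevant hQ hpos l hε)
  let ι : MvPolynomial (Fin (n + 1)) K →+* A := (algebraMap R A).comp (Ideal.Quotient.mk Q)
  have hι : ∀ F G, coneParam K a F = coneParam K a G → ι F = ι G := fun F G h =>
    congrArg (algebraMap R A) ((hmk F G).2 h)
  have hdvd : ι (X l.succ) ∣ ι (monomial v 1) := by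
    refine dvd_of_isCohenMacaulayLocalRing (hCM.2 (RingHom.ker ε)) hdim ?_
    -- The colon ideal (x_l : x^v). It suffices that its radical contains each variable, since the
    -- variables generate the maximal ideal.
    let J : Ideal A := Submodule.comap (LinearMap.toSpanSingleton A A (ι (monomial v 1)))
      (Ideal.span {ι (X l.succ)})
    have hJ : ∀ r, r ∈ J ↔ ι (X l.succ) ∣ r * ι (monomial v 1) := by
      intro r
      simp [J, Ideal.mem_span_singleton]
    suffices hrad : IsLocalRing.maximalIdeal A ≤ J.radical by
      intro r hr
      obtain ⟨k, hk⟩ := hrad hr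
      exact ⟨k, (hJ _).1 hk⟩
    have hmax : IsLocalRing.maximalIdeal A = (RingHom.ker ε).map (algebraMap R A) :=
      (Localization.AtPrime.map_eq_maximalIdeal).symm
    rw [hmax, Ideal.map_le_iff_le_comap]
    intro r hr
    obtain ⟨F, rfl⟩ := Ideal.Quotient.mk_surjective r
    rw [RingHom.mem_ker, hε'] at hr
    change F ∈ J.radical.comap ι
    refine (Ideal.span_le.2 ?_) (mem_span_X_of_constantCoeff_eq_zero hr)
    rintro _ ⟨i, rfl⟩
    change ι (X i) ∈ J.radical
    refine Fin.cases ?_ (fun i => ?_) i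
    · refine ⟨d, (hJ _).2 ⟨ι (monomial q 1), ?_⟩⟩
      rw [← map_pow, ← map_mul, ← map_mul]
      refine hι _ _ ?_
      rw [X_pow_eq_monomial, X, monomial_mul, monomial_mul, coneParam_monomial,
        coneParam_monomial, add_comm _ v, add_comm _ q, hd, ← hw, map_add (coneWeight a) v]
      simp [coneWeight, Finsupp.weight_single, coneExponent]
    -- On the cone x_i^(a_l) = x_l^(a_i) x_0^(a_l - a_i); positivity of a_i leaves a factor x_l to
    -- split off, and maximality of a_l makes the exponent of x_0 legitimate.
    · refine ⟨a l, (hJ _).2 (Dvd.dvd.mul_right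
        ⟨ι (X l.succ ^ (a i - 1) * X 0 ^ (a l - a i)), ?_⟩ _)⟩
      rw [← map_pow, ← map_mul, ← mul_assoc, ← pow_succ']
      refine hι _ _ ?_
      have h1 := hl i
      have h2 := hpos i
      simp only [map_mul, map_pow, coneParam_X, coneExponent, Fin.cons_succ, Fin.cons_zero,
        pow_zero, Polynomial.monomial_pow, Polynomial.monomial_mul_monomial, ← pow_mul, one_mul,
        one_pow, mul_one]
      rw [Nat.sub_add_cancel (by omega), Nat.add_sub_cancel' h1, mul_comm]
  obtain ⟨z, hz⟩ := hdvd
  obtain ⟨⟨g, s⟩, hgs⟩ := IsLocalization.surj (RingHom.ker ε).primeCompl z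
  obtain ⟨G, rfl⟩ := Ideal.Quotient.mk_surjective g
  obtain ⟨s, hs⟩ := s
  obtain ⟨S, rfl⟩ := Ideal.Quotient.mk_surjective s
  refine exists_add_single_of_coneParam_mul_eq (S := S) (G := G) (K := K) ?_ ((hmk _ _).1 (hinj ?_))
  · intro h
    exact hs (by rw [SetLike.mem_coe, RingHom.mem_ker, hε', h])
  · change ι (monomial v 1 * S) = ι (X l.succ * G)
    change z * ι S = ι G at hgs
    rw [map_mul, map_mul, hz, ← hgs, mul_assoc]

end CohenMacaulay

/-! ### The number of generators -/

section Bound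

open Finsupp
open scoped MonomialOrder

variable {n : ℕ} {a : Fin n → ℕ}

lemma zero_notMem_initialExponents {e : Equiv.Perm (Fin n)} :
    0 ∉ initialExponents a (revLex e) := by
  rintro ⟨w, hw, -⟩
  rw [revLex_lt_iff] at hw
  rcases hw with h | ⟨h', k, h, -⟩
  · simp at h
  · have : w = 0 := (degree_eq_zero_iff w).1 (by simpa using h')
    simp [this] at h

/-- A smaller monomial of the same positive weight would have degree one, and distinct variables
have distinct weights. -/
lemma single_notMem_initialExponents (ha_inj : Function.Injective a) (ha_pos : ∀ i, 0 < a i)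
    {e : Equiv.Perm (Fin n)} (i : Fin n) : single i 1 ∉ initialExponents a (revLex e) := by
  rintro ⟨w, hw, hwt⟩
  rw [weight_single, one_smul] at hwt
  have hd : w.degree ≤ 1 := by
    rw [revLex_lt_iff] at hw
    rcases hw with h | ⟨h, -⟩
    · simpa using h.le
    · simpa using h.le
  obtain ⟨j, hj⟩ : ∃ j, w j ≠ 0 := by
    by_contra! h
    have h0 : w = 0 := Finsupp.ext h
    have := ha_pos i
    rw [h0, map_zero] at hwt
    omega
  obtain ⟨b, rfl⟩ := exists_add_single_of_pos hj
  have hb : b = 0 := (degree_eq_zero_iff b).1 (by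
    rw [map_add, degree_single] at hd; omega)
  rw [hb, zero_add, weight_single, one_smul] at hwt
  rw [hb, zero_add, ha_inj hwt] at hw
  exact lt_irrefl _ hw

variable {K : Type*} [Field K]

/-- If the projective curve is arithmetically Cohen-Macaulay, then the smallest variable is a
nonzerodivisor modulo the initial ideal. -/
theorem mem_initialExponents_of_add_single (hCM : IsArithmeticallyCohenMacaulay K a)
    (hpos : ∀ i, a i ≠ 0) {l : Fin n} (hl : ∀ i, a i ≤ a l) {e : Equiv.Perm (Fin n)}
    {k₀ : Fin n} (hk₀ : ∀ k, k ≤ k₀) (he : e k₀ = l) {w : Fin n →₀ ℕ}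
    (h : w + single l 1 ∈ initialExponents a (revLex e)) :
    w ∈ initialExponents a (revLex e) := by
  obtain ⟨v, hv, hwt⟩ := h
  rw [revLex_lt_iff] at hv
  rcases hv with hd | ⟨hd, k, hk, hlt⟩
  · rw [map_add, degree_single] at hd
    obtain ⟨p, hpd, hpw⟩ := exists_add_single_of_isArithmeticallyCohenMacaulay hCM hpos hl
      (v := cons 0 v) (q := cons 0 w) (d := w.degree + 1 - v.degree)
      (by simp only [map_add, degree_cons, degree_single]; omega)
      (by
        rw [map_add, coneWeight_cons, coneWeight_cons, hwt, map_add, weight_single,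
          coneWeight, weight_single]
        simp [coneExponent])
    rw [← cons_tail p, map_add, degree_cons, degree_single, degree_cons] at hpd
    rw [← cons_tail p, map_add, coneWeight_cons, coneWeight_cons, hwt, map_add, coneWeight,
      weight_single, weight_single] at hpw
    -- Dropping x_0 only lowers the degree, so `p.tail` has degree at most |v| - 1 < |w|: it is
    -- smaller than `w` by degree alone.
    refine ⟨p.tail, (revLex_lt_iff _ _ _).2 (Or.inl (by omega)), ?_⟩
    simpa [coneExponent] using hpw
  -- Either the exponents first differ at x_l, where `v` has the larger one, or `v` agrees there
  -- with `w + single l 1`.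
  · have hvl : v l ≠ 0 := by
      rw [← he]
      rcases (hk₀ k).eq_or_lt with rfl | hlt'
      · omega
      · rw [hlt k₀ hlt', he]
        simp
    obtain ⟨b, rfl⟩ := exists_add_single_of_pos hvl
    refine ⟨b, (revLex_lt_iff _ _ _).2 (Or.inr ⟨?_, k, ?_, fun j hj => ?_⟩), ?_⟩
    · simpa [map_add] using hd
    · simpa using hk
    · simpa using hlt j hj
    · simpa [map_add] using hwt

/-- The standard monomials without `x_l` have distinct weights modulo `a_l`. -/
lemma eq_of_weight_modEq {m : MonomialOrder (Fin n)} {l : Fin n}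
    (hcancel : ∀ w, w + single l 1 ∈ initialExponents a m → w ∈ initialExponents a m)
    {u v : Fin n →₀ ℕ} (hu : u ∉ initialExponents a m) (hv : v ∉ initialExponents a m)
    (hul : u l = 0) (hvl : v l = 0) (h : weight a u ≡ weight a v [MOD a l]) : u = v := by
  wlog hle : weight a v ≤ weight a u generalizing u v
  · exact (this hv hu hvl hul h.symm (le_of_not_ge hle)).symm
  obtain ⟨k, hk⟩ := (Nat.modEq_iff_dvd' hle).1 h.symm
  have hcancel' : ∀ k, v + single l k ∉ initialExponents a m := by
    intro k
    induction k with
    | zero => simpa using hv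
    | succ k ih =>
      intro h
      rw [single_add, ← add_assoc] at h
      exact ih (hcancel _ h)
  have hw : weight a (v + single l k) = weight a u := by
    rw [map_add, weight_single, smul_eq_mul, mul_comm, ← hk]
    omega
  -- Two standard monomials of equal weight coincide, since the larger would be initial.
  have heq : u = v + single l k := by
    rcases lt_trichotomy (m.toSyn u) (m.toSyn (v + single l k)) with h | h | h
    · exact absurd ⟨u, h, hw.symm⟩ (hcancel' k)
    · exact m.toSyn.injective h
    · exact absurd ⟨_, h, hw⟩ hu
  have hk0 : k = 0 := by simpa [hul, hvl] using (DFunLike.congr_fun heq l).symm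
  simpa [hk0] using heq

/-- There are at most `a_l` standard monomials without `x_l`. -/
lemma exists_finset_standard {m : MonomialOrder (Fin n)} {l : Fin n} (hal : 0 < a l)
    (hcancel : ∀ w, w + single l 1 ∈ initialExponents a m → w ∈ initialExponents a m) :
    ∃ B : Finset (Fin n →₀ ℕ),
      (∀ v, v ∈ B ↔ v ∉ initialExponents a m ∧ v.support ⊆ Finset.univ.erase l) ∧
        B.card ≤ a l := by
  have hsupp : ∀ v : Fin n →₀ ℕ, v.support ⊆ Finset.univ.erase l ↔ v l = 0 := by
    intro v
    constructor
    · intro h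
      by_contra h0
      simpa using h (mem_support_iff.2 h0)
    · rintro h i hi
      refine Finset.mem_erase.2 ⟨?_, Finset.mem_univ _⟩
      rintro rfl
      exact mem_support_iff.1 hi h
  let T : Set (Fin n →₀ ℕ) := {v | v ∉ initialExponents a m ∧ v.support ⊆ Finset.univ.erase l}
  have hmaps : Set.MapsTo (fun v => weight a v % a l) T (Finset.range (a l) : Set ℕ) :=
    fun v _ => Finset.mem_coe.2 (Finset.mem_range.2 (Nat.mod_lt _ hal))
  have hinj : Set.InjOn (fun v => weight a v % a l) T := fun u hu v hv h =>
    eq_of_weight_modEq hcancel hu.1 hv.1 ((hsupp u).1 hu.2) ((hsupp v).1 hv.2) h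
  have hfin : T.Finite := Set.Finite.of_injOn hmaps hinj (Finset.finite_toSet _)
  refine ⟨hfin.toFinset, fun v => hfin.mem_toFinset, ?_⟩
  have := Finset.card_le_card_of_injOn (s := hfin.toFinset) (t := Finset.range (a l)) _
    (by simpa using hmaps) (by simpa using hinj)
  simpa using this

end Bound

end MonomialCurve

theorem proposition3p4 {K : Type*} [Field K] {n : ℕ} (hn : 2 ≤ n) (a : Fin n → ℕ)
    (ha_pos : ∀ i, 0 < a i) (ha_inj : Function.Injective a)
    (ha_gcd : Finset.univ.gcd a = 1)
    (ha_max : ∀ i, i ≠ ⟨n - 1, by omega⟩ → a i < a ⟨n - 1, by omega⟩)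
    (e : Equiv.Perm (Fin n)) (he : e ⟨n - 1, by omega⟩ = ⟨n - 1, by omega⟩)
    (hCM : MonomialCurve.IsArithmeticallyCohenMacaulay K a) :
    (MonomialCurve.minimalMonomialGenerators (MonomialCurve.initialIdeal (MonomialCurve.revLex e)
        (MonomialCurve.toricIdeal K a))).encard ≤ ((a ⟨n - 1, by omega⟩).choose (n - 2) : ℕ) ∧
      (MonomialCurve.initialIdeal (MonomialCurve.revLex e)
        (MonomialCurve.toricIdeal K a)).spanRank ≤ ((a ⟨n - 1, by omega⟩).choose (n - 2) : ℕ) := by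
  have hle : ∀ i, a i ≤ a ⟨n - 1, by omega⟩ := by
    intro i
    by_cases hi : i = ⟨n - 1, by omega⟩
    · rw [hi]
    · exact (ha_max i hi).le
  have hlast : ∀ k : Fin n, k ≤ ⟨n - 1, by omega⟩ := fun k => Fin.le_def.2 (by
    have := k.2
    simp only
    omega)
  generalize (⟨n - 1, by omega⟩ : Fin n) = l at *
  have hcancel : ∀ w, w + Finsupp.single l 1 ∈
      MonomialCurve.initialExponents a (MonomialCurve.revLex e) →
      w ∈ MonomialCurve.initialExponents a (MonomialCurve.revLex e) := fun w =>
    MonomialCurve.mem_initialExponents_of_add_single hCM (fun i => (ha_pos i).ne') hle hlast he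
  obtain ⟨B, hB, hcard⟩ := MonomialCurve.exists_finset_standard (ha_pos l) hcancel
  have hs : (Finset.univ.erase l).card = n - 1 := by
    rw [Finset.card_erase_of_mem (Finset.mem_univ _), Finset.card_univ, Fintype.card_fin]
  have hG : ∀ u, Minimal (· ∈ MonomialCurve.initialExponents a (MonomialCurve.revLex e)) u →
      u.support ⊆ Finset.univ.erase l := by
    intro u hu i hi
    refine Finset.mem_erase.2 ⟨?_, Finset.mem_univ _⟩
    rintro rfl
    obtain ⟨b, rfl⟩ := MonomialCurve.exists_add_single_of_pos (Finsupp.mem_support_iff.1 hi)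
    exact MonomialCurve.notMem_of_eq_add_single hu rfl (hcancel b hu.1)
  have hbound : (MonomialCurve.minimalMonomialGenerators (MonomialCurve.initialIdeal
      (MonomialCurve.revLex e) (MonomialCurve.toricIdeal K a))).encard ≤
      ((a l).choose (n - 2) : ℕ) := by
    rw [MonomialCurve.minimalMonomialGenerators_eq (K := K)]
    have := MonomialCurve.encard_minimal_le_choose (Finset.card_pos.1 (by omega)) hB
      MonomialCurve.zero_notMem_initialExponents
      (MonomialCurve.single_notMem_initialExponents ha_inj ha_pos) hG hcard
    rwa [hs, show n - 1 - 1 = n - 2 by omega] at this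
  refine ⟨hbound, ?_⟩
  have hspan := MonomialCurve.initialIdeal_eq_span_minimal K a (MonomialCurve.revLex e)
  generalize MonomialCurve.minimalMonomialGenerators (K := K) _ = G at hbound hspan
  rw [hspan]
  refine (Submodule.spanRank_span_le_card _).trans ?_
  -- The bound itself shows that the generating set is finite, so its cardinality can be compared
  -- with the cardinal `spanRank`.
  obtain ⟨k, hk⟩ := ENat.ne_top_iff_exists.1 (ne_top_of_le_ne_top (ENat.natCast_ne_top _) hbound)
  have hfin : G.Finite := Set.finite_of_encard_eq_coe hk.symm
  lift G to Finset (Fin n →₀ ℕ) using hfin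
  rw [Set.encard_coe_eq_coe_finsetCard, Nat.cast_le] at hbound
  classical
  rw [← Finset.coe_image, Finset.coe_sort_coe, Cardinal.mk_coe_finset, Nat.cast_le]
  exact Finset.card_image_le.trans hbound
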